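/- Let $1\le r$ and $2r\le d$ be integers, let $H$ be a complex Hilbert space of dimension $d$, and let $S$ be a finite set of rank-$r$ orthogonal projections on $H$. Call a map $f$ from the unit vectors of $H$ to $\{0,C,1\}$ a *state labelling* if it does not depend on the phase of the vector and if, in every orthonormal basis of $H$, at least one vector has label $C$ or $1$ and at most one vector has label $1$. Such an $f$ induces an *inherited labelling* $g_f$ of the orthogonal projections $P$ on $H$: $g_f(P)=0$ if $P=\sum_i|\psi_i\rangle\langle\psi_i|$ for some orthonormal family $(\psi_i)$ with $f(\psi_i)=0$ for all $i$; otherwise $g_f(P)=1$ if $P=\sum_i|\psi_i\rangle\langle\psi_i|$ for some orthonormal family $(\psi_i)$ with $f(\psi_i)\in\{0,1\}$ for all $i$; otherwise $g_f(P)=C$ (a contextual valuation). Then there is a state labelling $f$ such that the inherited labelling $g_f$ is consistent on $S$ (every subset of $S$ whose elements sum to the identity contains some $P$ with $g_f(P)\in\{C,1\}$, and no two projections $P,Q\in S$ with $PQ=0$ both have label $1$), and at most $$\bigl(I_{1/2}(r,d-r)-I_{r/d}(r,d-r)\bigr)\,|S|$$ elements of $S$ receive the contextual valuation $C$. Here $$I_x(a,b)=\frac{\Gamma(a+b)}{\Gamma(a)\Gamma(b)}\int_0^x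 t^{a-1}(1-t)^{b-1}\,dt$$ is the regularised incomplete beta function. -/

import Mathlib

namespace KSValuation

/-- The three possible labels of a projector: a noncontextual `0`, a contextual valuation `C`,
a noncontextual `1`. -/
inductive Label : Type
  | zero
  | contextual
  | one

section

variable {H : Type*} [NormedAddCommGroup H] [InnerProductSpace ℂ H]

/-- `f` is an admissible labelling of the pure states (unit vectors up to phase) of the
finite-dimensional Hilbert space `H`: it is insensitive to phases, and in every orthonormal basis
at least one vector is labelled `C` or `1` and at most one vector is labelled `1`.
Only the values of `f` at unit vectors matter. -/
structure IsStateLabelling (f : H → Label) : Prop where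
  phase : ∀ (c : ℂ) (ψ : H), ‖c‖ = 1 → ‖ψ‖ = 1 → f (c • ψ) = f ψ
  exists_ne_zero : ∀ b : OrthonormalBasis (Fin (Module.finrank ℂ H)) ℂ H,
    ∃ i, f (b i) ≠ Label.zero
  one_unique : ∀ (b : OrthonormalBasis (Fin (Module.finrank ℂ H)) ℂ H)
    (i j : Fin (Module.finrank ℂ H)), f (b i) = Label.one → f (b j) = Label.one → i = j

/-- `ψ` is a maximally fine-grained decomposition of `P`: the `ψ i` are orthonormal and
`P = ∑ i, |ψ i⟩⟨ψ i|`. (For an orthogonal projection `P` and unit vectors `ψ i`, the second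
condition already forces the `ψ i` to be pairwise orthogonal.) -/
def IsDecomposition (P : H →L[ℂ] H) {n : ℕ} (ψ : Fin n → H) : Prop :=
  Orthonormal ℂ ψ ∧ P = ∑ i, InnerProductSpace.rankOne ℂ (ψ i) (ψ i)

open Classical in
/-- The label that a projector inherits from the labels of the states in its decompositions. -/
noncomputable def inherited (f : H → Label) (P : H →L[ℂ] H) : Label :=
  if ∃ (n : ℕ) (ψ : Fin n → H), IsDecomposition P ψ ∧ ∀ i, f (ψ i) = Label.zero then
    Label.zero
  else if ∃ (n : ℕ) (ψ : Fin n → H), IsDecomposition P ψ ∧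
      ∀ i, f (ψ i) = Label.zero ∨ f (ψ i) = Label.one then
    Label.one
  else
    Label.contextual

/-- `P` is an orthogonal projection of rank `r`. -/
def IsRankProjector [CompleteSpace H] (r : ℕ) (P : H →L[ℂ] H) : Prop :=
  IsStarProjection P ∧ Module.finrank ℂ (LinearMap.range (P : H →ₗ[ℂ] H)) = r

/-- `g` is an admissible labelling of the available projectors `S`: in every context (a set of
available projectors that sum to the identity) at least one is labelled `C` or `1`, and no two
orthogonal available projectors are both labelled `1`. -/
structure IsProjectorLabelling (S : Finset (H →L[ℂ] H)) (g : (H →L[ℂ] H) → Label) : Prop where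
  exists_ne_zero : ∀ K : Finset (H →L[ℂ] H), K ⊆ S → ∑ P ∈ K, P = 1 →
    ∃ P ∈ K, g P ≠ Label.zero
  not_both_one : ∀ P ∈ S, ∀ Q ∈ S, P * Q = 0 → ¬(g P = Label.one ∧ g Q = Label.one)

end

/-- The regularised incomplete beta function `I_x(a, b)`, for `a, b > 0` and `0 ≤ x ≤ 1`. -/
noncomputable def regIncBeta (x a b : ℝ) : ℝ :=
  (∫ t in (0 : ℝ)..x, t ^ (a - 1) * (1 - t) ^ (b - 1)) / ProbabilityTheory.beta a b

end KSValuation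

/-!
Fix a unit vector `φ` and label a state `ψ` by its overlap `|⟨ψ, φ⟩|²`: label `1` above `1 / 2`, label
`0` below `1 / d`, and `C` in between (`overlapLabel`). Since the overlaps with the members of an
orthonormal basis sum to `1`, this is a state labelling, and the same count shows that the inherited
labelling of projectors is consistent (`isProjectorLabelling_inherited_overlapLabel`).

A projector `P` of rank `r` is contextual only if `r / d ≤ ‖P φ‖² ≤ 1 / 2`. Below `r / d`, the range of
`P` has an orthonormal basis over which `‖P φ‖²` is spread evenly, so that each vector has label `0`;
above `1 / 2`, it has an orthonormal basis containing the direction of `P φ`, whose label is `1`,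
while the other vectors are orthogonal to `φ` and have label `0`.

For `φ` the direction of a uniformly random point of the unit ball, `‖P φ‖²` follows the beta law with
parameters `r` and `d - r` (`measure_starProjection_sector`): split the space as the range of `P` plus
its orthogonal complement; the squared norms `u`, `v` of the components have densities proportional
to `u ^ (r - 1)` and `v ^ (d - r - 1)`, and in the coordinates `n = u + v`, `t = u / n` the measure
factors into a function of `n` times `t ^ (r - 1) * (1 - t) ^ (d - r - 1)`. The expected number of
contextual projectors in `S` is therefore at most the stated bound, and some `φ` attains at most the
expectation (`exists_ncard_sector_le`).
-/

namespace KSValuation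

section BetaLaw

open MeasureTheory Set Metric
open scoped ENNReal

/-! ### The law of the squared norm -/

/-- The measure `m * u ^ (m - 1) du` on the positive half-line. Up to a constant factor it is the law
of `u = ‖x‖ ^ 2` under Lebesgue measure on a complex space of dimension `m`. -/
noncomputable def radialMeasure (m : ℕ) : Measure ℝ :=
  (volume.restrict (Ioi 0)).withDensity fun u ↦ ENNReal.ofReal (m * u ^ (m - 1))

instance (m : ℕ) : SFinite (radialMeasure m) := by
  unfold radialMeasure; infer_instance

theorem radialMeasure_Ico {m : ℕ} (hm : 1 ≤ m) {a b : ℝ} (hab : a ≤ b) :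
    radialMeasure m (Ico a b) = ENNReal.ofReal (max b 0 ^ m - max a 0 ^ m) := by
  have hab' : max a 0 ≤ max b 0 := max_le_max_right 0 hab
  have hset : (Ico a b ∩ Ioi 0 : Set ℝ) =ᵐ[volume] Ioc (max a 0) (max b 0) := by
    have hU : (Ico (max a 0) (max b 0) : Set ℝ) =ᵐ[volume] Ioc (max a 0) (max b 0) :=
      Ico_ae_eq_Ioc
    refine Filter.EventuallyEq.trans ?_ hU
    have h0 : ∀ᵐ u : ℝ, u ≠ 0 := by simp [ae_iff]
    filter_upwards [h0] with u hu
    apply propext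
    change (u ∈ Ico a b ∩ Ioi 0) ↔ u ∈ Ico (max a 0) (max b 0)
    simp only [mem_inter_iff, mem_Ico, mem_Ioi, max_le_iff, lt_max_iff]
    constructor
    · rintro ⟨⟨h1, h2⟩, h3⟩
      exact ⟨⟨h1, h3.le⟩, Or.inl h2⟩
    · rintro ⟨⟨h1, h2⟩, h3⟩
      have := lt_of_le_of_ne h2 hu.symm
      exact ⟨⟨h1, h3.resolve_right (not_lt.2 h2)⟩, this⟩
  rw [radialMeasure, withDensity_apply _ measurableSet_Ico,
    Measure.restrict_restrict measurableSet_Ico, Measure.restrict_congr_set hset,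
    ← ofReal_integral_eq_lintegral_ofReal]
  · rw [← intervalIntegral.integral_of_le hab', intervalIntegral.integral_const_mul, integral_pow]
    congr 1
    have : (m : ℝ) ≠ 0 := by positivity
    rw [Nat.sub_add_cancel hm]
    push_cast [Nat.cast_sub hm]
    rw [sub_add_cancel, mul_div_cancel₀ _ this]
  · exact ((by fun_prop : Continuous fun u : ℝ ↦ (m : ℝ) * u ^ (m - 1)).integrableOn_Icc).mono_set
      Ioc_subset_Icc_self
  · refine (ae_restrict_iff' measurableSet_Ioc).2 (Filter.Eventually.of_forall fun u hu ↦ ?_)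
    have : 0 ≤ u := (le_max_right a 0).trans hu.1.le
    positivity

/-- Lebesgue measure of a ball of radius `√c` in real dimension `2 * m` is proportional to `c ^ m`,
so `‖x‖ ^ 2` has density proportional to `m * u ^ (m - 1)`. -/
theorem map_norm_sq_addHaar {E : Type*} [NormedAddCommGroup E] [NormedSpace ℝ E]
    [FiniteDimensional ℝ E] [MeasurableSpace E] [BorelSpace E] (μ : Measure E)
    [μ.IsAddHaarMeasure] {m : ℕ} (hm : 1 ≤ m) (hE : Module.finrank ℝ E = 2 * m) :
    μ.map (fun x ↦ ‖x‖ ^ 2) = μ (ball 0 1) • radialMeasure m := by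
  have : Nontrivial E := Module.nontrivial_of_finrank_pos (R := ℝ) (by omega)
  have hmeas : Measurable fun x : E ↦ ‖x‖ ^ 2 := by fun_prop
  have hball (c : ℝ) : μ (ball 0 √c) = ENNReal.ofReal (max c 0 ^ m) * μ (ball 0 1) := by
    rw [Measure.addHaar_ball μ 0 (Real.sqrt_nonneg c), hE, pow_mul, Real.sq_sqrt']
  have key (a b : ℝ) (hab : a < b) : μ.map (fun x ↦ ‖x‖ ^ 2) (Ico a b) =
      (μ (ball 0 1) • radialMeasure m) (Ico a b) := by
    have hpre : (fun x : E ↦ ‖x‖ ^ 2) ⁻¹' Ico a b = ball 0 √b \ ball 0 √a := by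
      ext x
      simp [Real.lt_sqrt (norm_nonneg x), and_comm]
    rw [Measure.map_apply hmeas measurableSet_Ico, hpre, measure_sdiff
      (ball_subset_ball (Real.sqrt_le_sqrt hab.le)) measurableSet_ball.nullMeasurableSet
      measure_ball_lt_top.ne, hball, hball, Measure.smul_apply, radialMeasure_Ico hm hab.le,
      ENNReal.ofReal_sub _ (by positivity), smul_eq_mul, ENNReal.mul_sub, mul_comm,
      mul_comm (ENNReal.ofReal (max a 0 ^ m))]
    exact fun _ _ ↦ measure_ball_lt_top.ne
  refine Measure.ext_of_Ico' _ _ (fun a b hab ↦ ?_) key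
  rw [key a b hab, Measure.smul_apply, radialMeasure_Ico hm hab.le]
  exact ENNReal.mul_ne_top measure_ball_lt_top.ne ENNReal.ofReal_ne_top

/-! ### The proportion of two radial variables -/

/-- On the positive quadrant, the pairs `(u, v)` with `u + v < 1` whose proportion `u / (u + v)` lies in
`[a, b]`. The condition is written without division; only the positive quadrant matters, since
`radialMeasure` lives on the positive half-line. -/
def sector (a b : ℝ) : Set (ℝ × ℝ) :=
  {z | z.1 + z.2 < 1 ∧ a * (z.1 + z.2) ≤ z.1 ∧ z.1 ≤ b * (z.1 + z.2)}

theorem measurableSet_sector (a b : ℝ) : MeasurableSet (sector a b) := by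
  unfold sector
  measurability

theorem lintegral_eq_ofReal_mul_lintegral_comp_mul_left {c : ℝ} (hc : 0 < c) {g : ℝ → ℝ≥0∞}
    (hg : Measurable g) : ∫⁻ u, g u = ENNReal.ofReal c * ∫⁻ t, g (c * t) := by
  conv_lhs => rw [← Real.smul_map_volume_mul_left hc.ne', lintegral_smul_measure,
    lintegral_map hg (by fun_prop), abs_of_pos hc]
  rfl

/-- The beta kernel appears here: substituting `n = u + v` and then `u = n * t` separates the total
`n` from the proportion `t`. The constant `K` does not depend on `a` and `b`; its value is
irrelevant because only ratios of such measures matter. -/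
theorem prod_radialMeasure_sector (r s : ℕ) (hr : 1 ≤ r) (hs : 1 ≤ s) : ∃ K : ℝ≥0∞, ∀ a b : ℝ,
    (radialMeasure r).prod (radialMeasure s) (sector a b) =
      K * ∫⁻ t in Icc a b ∩ Ioo 0 1, ENNReal.ofReal (t ^ (r - 1) * (1 - t) ^ (s - 1)) := by
  refine ⟨∫⁻ n in Ioo (0 : ℝ) 1, ENNReal.ofReal (r * s * n ^ (r + s - 1)), fun a b ↦ ?_⟩
  -- The image of the positive part of the sector in the coordinates `(u, n)` with `n = u + v`.
  let D : Set (ℝ × ℝ) := {z | 0 < z.1 ∧ z.1 < z.2 ∧ z.2 < 1 ∧ a * z.2 ≤ z.1 ∧ z.1 ≤ b * z.2}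
  have hD : MeasurableSet D := by
    measurability
  let h : ℝ × ℝ → ℝ≥0∞ := D.indicator fun z ↦
    ENNReal.ofReal (r * z.1 ^ (r - 1)) * ENNReal.ofReal (s * (z.2 - z.1) ^ (s - 1))
  have hh : Measurable h := Measurable.indicator (by fun_prop) hD
  have h1 : (radialMeasure r).prod (radialMeasure s) (sector a b) =
      ∫⁻ u, ∫⁻ v, h (u, u + v) := by
    rw [← lintegral_indicator_one (measurableSet_sector a b), radialMeasure, radialMeasure,
      prod_withDensity (by fun_prop) (by fun_prop), Measure.prod_restrict,
      lintegral_withDensity_eq_lintegral_mul _ (by fun_prop)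
        (measurable_one.indicator (measurableSet_sector a b)),
      ← lintegral_indicator (measurableSet_Ioi.prod measurableSet_Ioi),
      ← lintegral_prod (μ := volume) (ν := volume) (fun z : ℝ × ℝ ↦ h (z.1, z.1 + z.2))
        (by fun_prop)]
    refine lintegral_congr fun z ↦ ?_
    by_cases hz : z ∈ Ioi (0 : ℝ) ×ˢ Ioi (0 : ℝ)
    · have hz' : z ∈ sector a b ↔ (z.1, z.1 + z.2) ∈ D := by
        have h1 : 0 < z.1 := hz.1
        have h2 : 0 < z.2 := hz.2
        simp [sector, D, h1, h2]
      by_cases hzs : z ∈ sector a b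
      · simp [h, hz, hzs, hz'.1 hzs]
      · simp [h, hz, hzs, mt hz'.2 hzs]
    · have : (z.1, z.1 + z.2) ∉ D := by
        rintro ⟨h1, h2, -⟩
        exact hz ⟨h1, by simpa using h2⟩
      simp [h, hz, this]
  have h2 : ∫⁻ u, ∫⁻ v, h (u, u + v) = ∫⁻ n, ∫⁻ u, h (u, n) := by
    rw [lintegral_lintegral_swap (f := fun n u ↦ h (u, n)) (by fun_prop)]
    exact lintegral_congr fun u ↦ lintegral_add_left_eq_self (fun n ↦ h (u, n)) u
  have h3 (n : ℝ) : ∫⁻ u, h (u, n) = (Ioo 0 1).indicator (fun n ↦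
      ENNReal.ofReal (r * s * n ^ (r + s - 1))) n *
      ∫⁻ t in Icc a b ∩ Ioo 0 1, ENNReal.ofReal (t ^ (r - 1) * (1 - t) ^ (s - 1)) := by
    by_cases hn : n ∈ Ioo (0 : ℝ) 1
    · have hn0 : 0 < n := hn.1
      rw [lintegral_eq_ofReal_mul_lintegral_comp_mul_left hn0 (by fun_prop),
        ← lintegral_const_mul _ (by fun_prop), indicator_of_mem hn,
        ← lintegral_indicator (measurableSet_Icc.inter measurableSet_Ioo),
        ← lintegral_const_mul _ (Measurable.indicator (by fun_prop)
          (measurableSet_Icc.inter measurableSet_Ioo))]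
      refine lintegral_congr fun t ↦ ?_
      have hiff : (n * t, n) ∈ D ↔ t ∈ Icc a b ∩ Ioo 0 1 := by
        simp only [D, mem_ofPred_eq, mem_inter_iff, mem_Icc, mem_Ioo, hn.2, true_and, mul_comm n t,
          mul_le_mul_iff_left₀ hn0]
        rw [mul_lt_iff_lt_one_left hn0]
        simp only [mul_pos_iff_of_pos_right hn0]
        tauto
      by_cases ht : t ∈ Icc a b ∩ Ioo 0 1
      · have ht0 : 0 < t := ht.2.1
        have ht1 : 0 < 1 - t := by linarith [ht.2.2]
        have hnt : 0 < n - n * t := by nlinarith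
        simp only [h, indicator_of_mem ht, indicator_of_mem (hiff.2 ht)]
        rw [← ENNReal.ofReal_mul (by positivity), ← ENNReal.ofReal_mul (by positivity),
          ← ENNReal.ofReal_mul (by positivity)]
        congr 1
        obtain ⟨r, rfl⟩ := Nat.exists_eq_add_of_le' hr
        obtain ⟨s, rfl⟩ := Nat.exists_eq_add_of_le' hs
        rw [show n - n * t = n * (1 - t) by ring, show r + 1 + (s + 1) - 1 = r + s + 1 by omega]
        simp only [Nat.add_sub_cancel, mul_pow, pow_add]
        ring
      · simp [h, ht, mt hiff.1 ht]
    · have : ∀ u, (u, n) ∉ D := by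
        rintro u ⟨h1, h2, h3, -⟩
        exact hn ⟨h1.trans h2, h3⟩
      simp [h, hn, this]
  rw [h1, h2, lintegral_congr h3, lintegral_mul_const _ (Measurable.indicator (by fun_prop)
    measurableSet_Ioo), lintegral_indicator measurableSet_Ioo]

/-! ### The regularised incomplete beta function -/

theorem regIncBeta_natCast (x : ℝ) {r s : ℕ} (hr : 1 ≤ r) (hs : 1 ≤ s) :
    regIncBeta x r s =
      (∫ t in (0 : ℝ)..x, t ^ (r - 1) * (1 - t) ^ (s - 1)) / ProbabilityTheory.beta r s := by
  have h (n : ℕ) (hn : 1 ≤ n) (y : ℝ) : y ^ ((n : ℝ) - 1) = y ^ (n - 1) := by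
    rw [← Real.rpow_natCast, Nat.cast_sub hn, Nat.cast_one]
  simp_rw [regIncBeta, h r hr, h s hs]

theorem beta_natCast {r s : ℕ} (hr : 1 ≤ r) (hs : 1 ≤ s) :
    ProbabilityTheory.beta r s = ∫ t in (0 : ℝ)..1, t ^ (r - 1) * (1 - t) ^ (s - 1) := by
  rw [ProbabilityTheory.beta_eq_betaIntegralReal _ _ (by positivity) (by positivity),
    Complex.betaIntegral]
  have h (n : ℕ) (hn : 1 ≤ n) (z : ℂ) : z ^ (((n : ℝ) : ℂ) - 1) = z ^ (n - 1) := by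
    rw [← Complex.cpow_natCast, Nat.cast_sub hn, Nat.cast_one, Complex.ofReal_natCast]
  have h' (t : ℝ) : (t : ℂ) ^ (r - 1) * (1 - (t : ℂ)) ^ (s - 1) =
      ((t ^ (r - 1) * (1 - t) ^ (s - 1) : ℝ) : ℂ) := by
    push_cast; rfl
  simp_rw [h r hr, h s hs, h']
  rw [intervalIntegral.integral_ofReal, Complex.ofReal_re]

theorem regIncBeta_le_regIncBeta {r s : ℕ} (hr : 1 ≤ r) (hs : 1 ≤ s) {a b : ℝ} (ha : 0 ≤ a)
    (hab : a ≤ b) (hb : b ≤ 1) : regIncBeta a r s ≤ regIncBeta b r s := by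
  have hbeta : 0 < ProbabilityTheory.beta r s :=
    ProbabilityTheory.beta_pos (by positivity) (by positivity)
  rw [← sub_nonneg, regIncBeta_natCast b hr hs, regIncBeta_natCast a hr hs, ← sub_div,
    intervalIntegral.integral_interval_sub_left
      (Continuous.intervalIntegrable (by fun_prop) _ _)
      (Continuous.intervalIntegrable (by fun_prop) _ _)]
  refine div_nonneg (intervalIntegral.integral_nonneg hab fun t ht ↦ ?_) hbeta.le
  have h0 : 0 ≤ t := ha.trans ht.1
  have h1 : 0 ≤ 1 - t := by linarith [ht.2]
  positivity

theorem lintegral_beta_kernel {r s : ℕ} (hr : 1 ≤ r) (hs : 1 ≤ s) {a b : ℝ} (ha : 0 ≤ a)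
    (hab : a ≤ b) (hb : b ≤ 1) :
    ∫⁻ t in Icc a b ∩ Ioo 0 1, ENNReal.ofReal (t ^ (r - 1) * (1 - t) ^ (s - 1)) =
      ENNReal.ofReal (ProbabilityTheory.beta r s) *
        ENNReal.ofReal (regIncBeta b r s - regIncBeta a r s) := by
  have hbeta : 0 < ProbabilityTheory.beta r s :=
    ProbabilityTheory.beta_pos (by positivity) (by positivity)
  have hcont : Continuous fun t : ℝ ↦ t ^ (r - 1) * (1 - t) ^ (s - 1) := by fun_prop
  have hset : (Icc a b ∩ Ioo 0 1 : Set ℝ) =ᵐ[volume] Ioc a b := by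
    have h1 : (Ioo (0 : ℝ) 1 : Set ℝ) =ᵐ[volume] Icc 0 1 := Ioo_ae_eq_Icc
    have h2 : (Icc a b : Set ℝ) =ᵐ[volume] Ioc a b := Ioc_ae_eq_Icc.symm
    refine ((Filter.EventuallyEq.refl _ (Icc a b)).inter h1).trans ?_
    rwa [inter_eq_left.2 (Icc_subset_Icc ha hb)]
  rw [Measure.restrict_congr_set hset, ← ENNReal.ofReal_mul hbeta.le,
    ← ofReal_integral_eq_lintegral_ofReal, ← intervalIntegral.integral_of_le hab,
    regIncBeta_natCast b hr hs, regIncBeta_natCast a hr hs, ← sub_div,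
    mul_div_cancel₀ _ hbeta.ne', intervalIntegral.integral_interval_sub_left
      (hcont.intervalIntegrable _ _) (hcont.intervalIntegrable _ _)]
  · exact hcont.integrableOn_Icc.mono_set Ioc_subset_Icc_self
  · refine (ae_restrict_iff' measurableSet_Ioc).2 (Filter.Eventually.of_forall fun t ht ↦ ?_)
    have h0 : 0 ≤ t := ha.trans ht.1.le
    have h1 : 0 ≤ 1 - t := by linarith [ht.2]
    positivity

/-! ### The squared norm of a projected random vector -/

/-- For a point uniformly distributed in the unit ball, the proportion of its squared norm lying in a
subspace of complex dimension `r` and codimension `s` follows the beta law with parameters `r`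
and `s`. -/
theorem measure_starProjection_sector {H : Type*} [NormedAddCommGroup H] [InnerProductSpace ℂ H]
    [FiniteDimensional ℂ H] [MeasurableSpace H] [BorelSpace H] (μ : Measure H)
    [μ.IsAddHaarMeasure] (V : Submodule ℂ H) {r s : ℕ} (hr : 1 ≤ r) (hs : 1 ≤ s)
    (hV : Module.finrank ℂ V = r) (hVo : Module.finrank ℂ Vᗮ = s) {a b : ℝ} (ha : 0 ≤ a)
    (hab : a ≤ b) (hb : b ≤ 1) :
    μ (ball 0 1 ∩ {x | a * ‖x‖ ^ 2 ≤ ‖V.starProjection x‖ ^ 2 ∧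
        ‖V.starProjection x‖ ^ 2 ≤ b * ‖x‖ ^ 2}) =
      ENNReal.ofReal (regIncBeta b r s - regIncBeta a r s) * μ (ball 0 1) := by
  have : ProperSpace H := FiniteDimensional.proper ℂ H
  have : FiniteDimensional ℝ V := FiniteDimensional.complexToReal V
  have : FiniteDimensional ℝ Vᗮ := FiniteDimensional.complexToReal Vᗮ
  let L : (V × Vᗮ) ≃L[ℝ] H :=
    ((V.prodEquivOfIsCompl Vᗮ V.isCompl_orthogonal).restrictScalars ℝ).toContinuousLinearEquiv
  have hL (z : V × Vᗮ) : L z = (z.1 : H) + z.2 := rfl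
  let μV : Measure V := Measure.addHaar
  let μW : Measure Vᗮ := Measure.addHaar
  let ν : Measure H := (μV.prod μW).map L
  have : ν.IsAddHaarMeasure := L.isAddHaarMeasure_map _
  -- Both sides of the claim scale in the same way with `μ`, so `μ` may be taken to be `ν`.
  suffices h : ν (ball 0 1 ∩ {x | a * ‖x‖ ^ 2 ≤ ‖V.starProjection x‖ ^ 2 ∧
        ‖V.starProjection x‖ ^ 2 ≤ b * ‖x‖ ^ 2}) =
      ENNReal.ofReal (regIncBeta b r s - regIncBeta a r s) * ν (ball 0 1) by
    rw [Measure.isAddLeftInvariant_eq_smul μ ν, Measure.smul_apply, Measure.smul_apply, h,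
      mul_smul_comm]
  obtain ⟨K, hK⟩ := prod_radialMeasure_sector r s hr hs
  have key (a b : ℝ) (ha : 0 ≤ a) (hab : a ≤ b) (hb : b ≤ 1) :
      ν (ball 0 1 ∩ {x | a * ‖x‖ ^ 2 ≤ ‖V.starProjection x‖ ^ 2 ∧
        ‖V.starProjection x‖ ^ 2 ≤ b * ‖x‖ ^ 2}) =
      μV (ball 0 1) * μW (ball 0 1) * K * ENNReal.ofReal (ProbabilityTheory.beta r s) *
        ENNReal.ofReal (regIncBeta b r s - regIncBeta a r s) := by
    have hmeas : MeasurableSet (ball 0 1 ∩ {x : H | a * ‖x‖ ^ 2 ≤ ‖V.starProjection x‖ ^ 2 ∧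
        ‖V.starProjection x‖ ^ 2 ≤ b * ‖x‖ ^ 2}) := by
      measurability
    have hpre : L ⁻¹' (ball 0 1 ∩ {x : H | a * ‖x‖ ^ 2 ≤ ‖V.starProjection x‖ ^ 2 ∧
        ‖V.starProjection x‖ ^ 2 ≤ b * ‖x‖ ^ 2}) =
        Prod.map (fun x : V ↦ ‖x‖ ^ 2) (fun y : Vᗮ ↦ ‖y‖ ^ 2) ⁻¹' sector a b := by
      ext ⟨x, y⟩
      have h1 : ‖(x : H) + y‖ ^ 2 = ‖x‖ ^ 2 + ‖y‖ ^ 2 := by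
        have := norm_add_sq_eq_norm_sq_add_norm_sq_of_inner_eq_zero (𝕜 := ℂ) (x : H) (y : H)
          (V.inner_right_of_mem_orthogonal x.2 y.2)
        simpa [sq] using this
      have h2 : V.starProjection ((x : H) + y) = x := by
        rw [map_add, V.starProjection_eq_self_iff.2 x.2,
          V.starProjection_apply_eq_zero_iff.2 y.2, add_zero]
      have h3 : (x : H) + y ∈ ball (0 : H) 1 ↔ ‖x‖ ^ 2 + ‖y‖ ^ 2 < 1 := by
        rw [mem_ball_zero_iff, ← h1, sq_lt_one_iff₀ (norm_nonneg _)]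
      simp only [mem_preimage, mem_inter_iff, hL, h3, mem_ofPred_eq, h1, h2, sector, Prod.map,
        Submodule.coe_norm]
    rw [Measure.map_apply (by fun_prop) hmeas, hpre,
      ← Measure.map_apply (by fun_prop) (measurableSet_sector a b),
      ← Measure.map_prod_map _ _ (by fun_prop) (by fun_prop),
      map_norm_sq_addHaar μV hr (by rw [finrank_real_of_complex, hV]),
      map_norm_sq_addHaar μW hs (by rw [finrank_real_of_complex, hVo]),
      Measure.prod_smul_left, Measure.prod_smul_right, Measure.smul_apply, Measure.smul_apply, hK,
      lintegral_beta_kernel hr hs ha hab hb]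
    simp only [smul_eq_mul, mul_assoc]
  -- The full ball is the case `a = 0`, `b = 1`, which determines the constant.
  have hball : (ball 0 1 : Set H) = ball 0 1 ∩ {x : H | 0 * ‖x‖ ^ 2 ≤ ‖V.starProjection x‖ ^ 2 ∧
        ‖V.starProjection x‖ ^ 2 ≤ 1 * ‖x‖ ^ 2} := by
    refine (inter_eq_left.2 fun x _ ↦ ?_).symm
    rw [mem_ofPred_eq, zero_mul, one_mul]
    refine ⟨by positivity, ?_⟩
    gcongr
    exact V.norm_starProjection_apply_le x
  have hbeta : 0 < ProbabilityTheory.beta r s :=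
    ProbabilityTheory.beta_pos (by positivity) (by positivity)
  have hone : regIncBeta 1 r s - regIncBeta 0 r s = 1 := by
    rw [regIncBeta_natCast _ hr hs, regIncBeta_natCast _ hr hs, ← beta_natCast hr hs,
      div_self hbeta.ne', intervalIntegral.integral_same, zero_div, sub_zero]
  rw [key a b ha hab hb]
  conv_rhs => rw [hball, key 0 1 le_rfl zero_le_one le_rfl, hone, ENNReal.ofReal_one, mul_one]
  rw [mul_comm]

/-- First moment method: some unit vector does at least as well as a random one. -/
theorem exists_ncard_sector_le {H : Type*} [NormedAddCommGroup H] [InnerProductSpace ℂ H]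
    [CompleteSpace H] {r s : ℕ} (hr : 1 ≤ r) (hs : 1 ≤ s) (hd : Module.finrank ℂ H = r + s)
    (S : Finset (H →L[ℂ] H)) (hS : ∀ P ∈ S, IsRankProjector r P) {a b : ℝ} (ha : 0 ≤ a)
    (hab : a ≤ b) (hb : b ≤ 1) :
    ∃ φ : H, ‖φ‖ = 1 ∧ ({P : H →L[ℂ] H | P ∈ S ∧ a ≤ ‖P φ‖ ^ 2 ∧ ‖P φ‖ ^ 2 ≤ b}.ncard : ℝ) ≤
      (regIncBeta b r s - regIncBeta a r s) * S.card := by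
  classical
  have : FiniteDimensional ℂ H := .of_finrank_pos (by omega)
  have : Nontrivial H := Module.nontrivial_of_finrank_pos (R := ℂ) (by omega)
  have : ProperSpace H := FiniteDimensional.proper ℂ H
  borelize H
  let B (P : H →L[ℂ] H) : Set H := {x | a * ‖x‖ ^ 2 ≤ ‖P x‖ ^ 2 ∧ ‖P x‖ ^ 2 ≤ b * ‖x‖ ^ 2}
  have hB (P : H →L[ℂ] H) : MeasurableSet (B P) := by
    measurability
  let ρ : Measure H := (Measure.addHaar : Measure H).restrict (ball 0 1)
  have hρ0 : ρ univ ≠ 0 := by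
    rw [Measure.restrict_apply_univ]; exact (measure_ball_pos _ _ one_pos).ne'
  have hρt : ρ univ ≠ ∞ := by
    rw [Measure.restrict_apply_univ]; exact measure_ball_lt_top.ne
  have : IsFiniteMeasure ρ := ⟨hρt.lt_top⟩
  have hP (P : H →L[ℂ] H) (hPS : P ∈ S) :
      ρ (B P) = ENNReal.ofReal (regIncBeta b r s - regIncBeta a r s) * ρ univ := by
    obtain ⟨h1, h2⟩ := hS P hPS
    obtain ⟨h3, h4⟩ := isStarProjection_iff_eq_starProjection_range.1 h1
    have h5 := Submodule.finrank_add_finrank_orthogonal (LinearMap.range (P : H →ₗ[ℂ] H))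
    have h6 := measure_starProjection_sector (Measure.addHaar : Measure H)
      (LinearMap.range (P : H →ₗ[ℂ] H)) hr hs h2 (by omega) ha hab hb
    rw [Measure.restrict_apply (hB P), Measure.restrict_apply_univ, ← h6, inter_comm]
    simp only [B]
    rw [← h4]
  -- `N x` counts the `P ∈ S` whose proportion at `x` lies in `[a, b]`.
  let N (x : H) : ℝ≥0∞ := ∑ P ∈ S, (B P).indicator 1 x
  have hN : Measurable N :=
    Finset.measurable_sum _ fun P _ ↦ measurable_one.indicator (hB P)
  have hρne : ρ ≠ 0 := fun h ↦ hρ0 (by simp [h])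
  obtain ⟨x, hx0, hx⟩ := exists_notMem_null_le_laverage hρne hN.aemeasurable
    (show ρ {0} = 0 by simp [ρ])
  have hx0' : ‖x‖ ≠ 0 := by simpa using hx0
  have hInt : ∫⁻ x, N x ∂ρ =
      S.card * ENNReal.ofReal (regIncBeta b r s - regIncBeta a r s) * ρ univ := by
    simp only [N]
    rw [lintegral_finsetSum _ fun P _ ↦ measurable_one.indicator (hB P)]
    simp_rw [lintegral_indicator_one (hB _)]
    rw [Finset.sum_congr rfl hP, Finset.sum_const, nsmul_eq_mul, mul_assoc]
  rw [laverage_eq, hInt, ENNReal.mul_div_cancel_right hρ0 hρt] at hx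
  refine ⟨(‖x‖⁻¹ : ℂ) • x, by simp [norm_smul, hx0'], ?_⟩
  have hset : {P : H →L[ℂ] H | P ∈ S ∧ a ≤ ‖P ((‖x‖⁻¹ : ℂ) • x)‖ ^ 2 ∧
      ‖P ((‖x‖⁻¹ : ℂ) • x)‖ ^ 2 ≤ b} = ↑{P ∈ S | x ∈ B P} := by
    ext P
    have h1 : ‖P ((‖x‖⁻¹ : ℂ) • x)‖ ^ 2 = ‖P x‖ ^ 2 / ‖x‖ ^ 2 := by
      rw [map_smul, norm_smul, mul_pow, norm_inv, Complex.norm_real, norm_norm, inv_pow,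
        inv_mul_eq_div]
    have h2 : 0 < ‖x‖ ^ 2 := by positivity
    simp only [h1, B, le_div_iff₀ h2, div_le_iff₀ h2, Finset.coe_filter, mem_ofPred_eq]
  have hNx : N x = (Finset.card {P ∈ S | x ∈ B P} : ℝ≥0∞) := by
    simp only [N, indicator_apply, Pi.one_apply]
    convert (Finset.natCast_card_filter (fun P ↦ x ∈ B P) S).symm
  have hp : 0 ≤ regIncBeta b r s - regIncBeta a r s :=
    sub_nonneg.2 (regIncBeta_le_regIncBeta hr hs ha hab hb)
  rw [hset, ncard_coe_finset, mul_comm (regIncBeta _ _ _ - _)]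
  rw [hNx, ← ENNReal.ofReal_natCast, ← ENNReal.ofReal_natCast,
    ← ENNReal.ofReal_mul (by positivity)] at hx
  exact (ENNReal.ofReal_le_ofReal_iff (by positivity)).1 hx

end BetaLaw

/-! ### Labelling by overlap with a reference state -/

section StateLabelling

variable {H : Type*} [NormedAddCommGroup H] [InnerProductSpace ℂ H]

open Classical in
/-- The labelling of states by their overlap with a reference state `φ`: label `1` if the overlap
exceeds `1 / 2`, label `0` if it is below `1 / d`, and `C` otherwise. (For `d ≥ 2` the first two
cases exclude each other.) -/
noncomputable def overlapLabel (d : ℕ) (φ ψ : H) : Label :=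
  if 1 / 2 < ‖inner ℂ ψ φ‖ ^ 2 then Label.one
  else if ‖inner ℂ ψ φ‖ ^ 2 < 1 / d then Label.zero
  else Label.contextual

theorem overlapLabel_eq_one_iff {d : ℕ} {φ ψ : H} :
    overlapLabel d φ ψ = Label.one ↔ 1 / 2 < ‖inner ℂ ψ φ‖ ^ 2 := by
  unfold overlapLabel
  split_ifs <;> simp_all

theorem overlapLabel_eq_zero_iff {d : ℕ} (hd : 2 ≤ d) {φ ψ : H} :
    overlapLabel d φ ψ = Label.zero ↔ ‖inner ℂ ψ φ‖ ^ 2 < 1 / d := by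
  have h : (1 : ℝ) / d ≤ 1 / 2 := one_div_le_one_div_of_le two_pos (by exact_mod_cast hd)
  unfold overlapLabel
  split_ifs with h1 h2
  · simpa using (h.trans h1.le)
  · simpa using h2
  · simpa using h2

theorem norm_inner_sq_add_norm_inner_sq_le {φ ψ χ : H} (hφ : ‖φ‖ = 1) (hψ : ‖ψ‖ = 1)
    (hχ : ‖χ‖ = 1) (h : inner ℂ ψ χ = 0) :
    ‖inner ℂ ψ φ‖ ^ 2 + ‖inner ℂ χ φ‖ ^ 2 ≤ 1 := by
  have hon : Orthonormal ℂ ![ψ, χ] := by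
    simp [orthonormal_vecCons_iff, hψ, hχ, h]
  simpa [hφ] using hon.sum_inner_products_le φ (s := Finset.univ)

/-- In an orthonormal basis the `d` overlaps with `φ` sum to `1`, so they cannot all be below `1 / d`
and no two of them can exceed `1 / 2`. -/
theorem isStateLabelling_overlapLabel {d : ℕ} (hd : Module.finrank ℂ H = d) (hd2 : 2 ≤ d) {φ : H}
    (hφ : ‖φ‖ = 1) : IsStateLabelling (overlapLabel d φ) where
  phase c ψ hc _ := by simp [overlapLabel, hc]
  exists_ne_zero b := by
    by_contra! h
    have h1 := b.sum_sq_norm_inner_right φ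
    have h2 : ∑ i, ‖inner ℂ (b i) φ‖ ^ 2 < ∑ _i : Fin (Module.finrank ℂ H), 1 / (d : ℝ) :=
      Finset.sum_lt_sum_of_nonempty ⟨⟨0, by omega⟩, Finset.mem_univ _⟩
        fun i _ ↦ (overlapLabel_eq_zero_iff hd2).1 (h i)
    have h3 : (d : ℝ) ≠ 0 := by positivity
    simp [h1, hφ, hd, h3] at h2
  one_unique b i j hi hj := by
    by_contra hij
    rw [overlapLabel_eq_one_iff] at hi hj
    linarith [norm_inner_sq_add_norm_inner_sq_le hφ (b.norm_eq_one i) (b.norm_eq_one j)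
      (b.inner_eq_zero hij)]

/-- Some orthonormal basis is unbiased with respect to a given vector `v`: all its elements have the
same overlap with `v`. -/
theorem exists_orthonormalBasis_norm_inner_sq_eq {E : Type*} [NormedAddCommGroup E]
    [InnerProductSpace ℂ E] {r : ℕ} (hr : 1 ≤ r) (hE : Module.finrank ℂ E = r) (v : E) :
    ∃ b : OrthonormalBasis (Fin r) ℂ E, ∀ i, ‖inner ℂ (b i) v‖ ^ 2 = ‖v‖ ^ 2 / r := by
  have : FiniteDimensional ℂ E := .of_finrank_pos (by omega)
  have : NeZero r := ⟨by omega⟩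
  let e : OrthonormalBasis (Fin r) ℂ E := (stdOrthonormalBasis ℂ E).reindex (finCongr hE)
  rcases eq_or_ne v 0 with rfl | hv
  · exact ⟨e, by simp⟩
  have ext (u : E) (hu : ‖u‖ = 1) : ∃ b : OrthonormalBasis (Fin r) ℂ E, b 0 = u := by
    obtain ⟨b, hb⟩ := Orthonormal.exists_orthonormalBasis_extension_of_card_eq (𝕜 := ℂ)
      (ι := Fin r) (v := fun _ ↦ u) (s := {0}) (by simpa using hE)
      ⟨fun _ ↦ hu, fun i j hij ↦ (hij (Subsingleton.elim i j)).elim⟩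
    exact ⟨b, hb 0 rfl⟩
  have hr0 : (0 : ℝ) < r := by positivity
  -- The normalised sum `u` of the vectors of `e` has equal overlap with all of them; a unitary that
  -- takes `u` to the direction of `v` takes `e` to the required basis.
  let u : E := ((√r : ℝ) : ℂ)⁻¹ • ∑ i, e i
  have hinner (i : Fin r) : inner ℂ (e i) u = ((√r : ℝ) : ℂ)⁻¹ := by
    simp [u, e.inner_eq_ite]
  have hu : ‖u‖ = 1 := by
    have h1 := e.sum_sq_norm_inner_right u
    simp only [hinner] at h1
    rw [← sq_eq_sq₀ (norm_nonneg _) zero_le_one, ← h1]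
    simp [Real.sq_sqrt hr0.le, hr0.ne']
  obtain ⟨b, hb⟩ := ext u hu
  obtain ⟨b', hb'⟩ := ext ((‖v‖⁻¹ : ℂ) • v) (by simp [norm_smul, hv])
  let U := b.equiv b' (Equiv.refl _)
  have hU : U u = (‖v‖⁻¹ : ℂ) • v := by
    rw [← hb, ← hb']; simp [U]
  have hv' : v = (‖v‖ : ℂ) • U u := by
    rw [hU, smul_smul, mul_inv_cancel₀ (by simpa using hv), one_smul]
  refine ⟨e.map U, fun i ↦ ?_⟩
  have : inner ℂ ((e.map U) i) v = (‖v‖ : ℂ) * ((√r : ℝ) : ℂ)⁻¹ := by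
    conv_lhs => rw [hv']
    rw [OrthonormalBasis.map_apply, inner_smul_right, U.inner_map_map, hinner]
  rw [this]
  simp [mul_pow, Real.sq_sqrt hr0.le, div_eq_mul_inv]

theorem isDecomposition_of_orthonormalBasis_range [CompleteSpace H] {P : H →L[ℂ] H}
    (hP : IsStarProjection P) {n : ℕ}
    (b : OrthonormalBasis (Fin n) ℂ (LinearMap.range (P : H →ₗ[ℂ] H))) :
    IsDecomposition P fun i ↦ (b i : H) := by
  refine ⟨b.orthonormal.comp_linearIsometry (Submodule.subtypeₗᵢ _), ?_⟩
  obtain ⟨h1, h2⟩ := isStarProjection_iff_eq_starProjection_range.1 hP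
  exact h2.trans b.starProjection_eq_sum_rankOne

theorem inner_apply_of_mem_range [CompleteSpace H] {P : H →L[ℂ] H} (hP : IsStarProjection P)
    (x : LinearMap.range (P : H →ₗ[ℂ] H)) (y : H) :
    inner ℂ (x : H) y = inner ℂ x (⟨P y, y, rfl⟩ : LinearMap.range (P : H →ₗ[ℂ] H)) := by
  obtain ⟨_, z, rfl⟩ := x
  have h1 : P (P z) = P z := DFunLike.congr_fun hP.isIdempotentElem.eq z
  have h2 := hP.isSelfAdjoint.isSymmetric (P z) y
  change inner ℂ (P z) y = inner ℂ (P z) (P y)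
  simp only [ContinuousLinearMap.coe_coe] at h2
  rw [← h2, h1]

/-- A basis of the range of `P` that is unbiased with respect to `P φ` has all overlaps with `φ` equal
to `‖P φ‖ ^ 2 / r < 1 / d`, so that `P` inherits the label `0`. -/
theorem inherited_ne_contextual_of_lt [CompleteSpace H] {d r : ℕ} (hd2 : 2 ≤ d) (hr : 1 ≤ r)
    {P : H →L[ℂ] H} (hP : IsRankProjector r P) {φ : H} (h : ‖P φ‖ ^ 2 < r / d) :
    inherited (overlapLabel d φ) P ≠ Label.contextual := by
  obtain ⟨b, hb⟩ := exists_orthonormalBasis_norm_inner_sq_eq hr hP.2 ⟨P φ, φ, rfl⟩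
  have hz : ∃ (n : ℕ) (ψ : Fin n → H), IsDecomposition P ψ ∧
      ∀ i, overlapLabel d φ (ψ i) = Label.zero := by
    refine ⟨r, fun i ↦ b i, isDecomposition_of_orthonormalBasis_range hP.1 b, fun i ↦ ?_⟩
    rw [overlapLabel_eq_zero_iff hd2, inner_apply_of_mem_range hP.1, hb]
    have hr0 : (0 : ℝ) < r := by positivity
    rw [div_lt_iff₀ hr0, one_div_mul_eq_div]
    exact h
  rw [inherited, if_pos hz]
  simp

/-- A basis of the range of `P` that contains the direction of `P φ` has one overlap with `φ` equal to
`‖P φ‖ ^ 2 > 1 / 2` and all others equal to `0`. -/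
theorem inherited_ne_contextual_of_gt [CompleteSpace H] {d r : ℕ} (hd2 : 2 ≤ d) (hr : 1 ≤ r)
    {P : H →L[ℂ] H} (hP : IsRankProjector r P) {φ : H} (h : 1 / 2 < ‖P φ‖ ^ 2) :
    inherited (overlapLabel d φ) P ≠ Label.contextual := by
  have : NeZero r := ⟨by omega⟩
  have : FiniteDimensional ℂ (LinearMap.range (P : H →ₗ[ℂ] H)) :=
    .of_finrank_pos (by rw [hP.2]; omega)
  let v : LinearMap.range (P : H →ₗ[ℂ] H) := ⟨P φ, φ, rfl⟩
  have hv : ‖v‖ ≠ 0 := by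
    intro h0
    have : ‖P φ‖ = 0 := h0
    norm_num [this] at h
  obtain ⟨b, hb⟩ := Orthonormal.exists_orthonormalBasis_extension_of_card_eq (𝕜 := ℂ)
    (ι := Fin r) (v := fun _ ↦ (‖v‖⁻¹ : ℂ) • v) (s := {0}) (by simpa using hP.2)
    ⟨fun _ ↦ by
      change ‖(‖v‖⁻¹ : ℂ) • v‖ = 1
      rw [norm_smul, norm_inv, Complex.norm_real, norm_norm, inv_mul_cancel₀ hv], fun i j hij ↦ (hij (Subsingleton.elim i j)).elim⟩
  have hb0 : b 0 = (‖v‖⁻¹ : ℂ) • v := hb 0 rfl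
  have hvb : v = (‖v‖ : ℂ) • b 0 := by
    rw [hb0, smul_smul, mul_inv_cancel₀ (by exact_mod_cast hv), one_smul]
  have ho : ∃ (n : ℕ) (ψ : Fin n → H), IsDecomposition P ψ ∧
      ∀ i, overlapLabel d φ (ψ i) = Label.zero ∨ overlapLabel d φ (ψ i) = Label.one := by
    refine ⟨r, fun i ↦ b i, isDecomposition_of_orthonormalBasis_range hP.1 b, fun i ↦ ?_⟩
    rw [overlapLabel_eq_zero_iff hd2, overlapLabel_eq_one_iff, inner_apply_of_mem_range hP.1]
    change ‖inner ℂ (b i) v‖ ^ 2 < _ ∨ _ < ‖inner ℂ (b i) v‖ ^ 2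
    rw [hvb, inner_smul_right, b.inner_eq_ite]
    rcases eq_or_ne i 0 with rfl | hi
    · right
      simpa using h
    · left
      simp only [hi, if_false, mul_zero, norm_zero]
      norm_num
      omega
  rw [inherited, if_pos ho]
  split_ifs <;> simp

theorem exists_isDecomposition_of_inherited_eq_one {P : H →L[ℂ] H} {f : H → Label}
    (h : inherited f P = Label.one) :
    ∃ (n : ℕ) (ψ : Fin n → H) (i : Fin n), IsDecomposition P ψ ∧ f (ψ i) = Label.one := by
  unfold inherited at h
  split_ifs at h with h1 h2
  obtain ⟨n, ψ, hψ, hf⟩ := h2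
  by_contra! hne
  exact h1 ⟨n, ψ, hψ, fun i ↦ (hf i).resolve_right (hne n ψ i hψ)⟩

theorem exists_isDecomposition_of_inherited_eq_zero {P : H →L[ℂ] H} {f : H → Label}
    (h : inherited f P = Label.zero) :
    ∃ (n : ℕ) (ψ : Fin n → H), IsDecomposition P ψ ∧ ∀ i, f (ψ i) = Label.zero := by
  unfold inherited at h
  split_ifs at h with h1
  exact h1

theorem IsDecomposition.apply_self {P : H →L[ℂ] H} {n : ℕ} {ψ : Fin n → H}
    (h : IsDecomposition P ψ) (i : Fin n) : P (ψ i) = ψ i := by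
  rw [h.2, sum_apply]
  simp [InnerProductSpace.rankOne_apply, orthonormal_iff_ite.1 h.1]

/-- If projectors summing to the identity all inherited the label `0`, their decompositions would
consist of `d` vectors in total (take traces) whose overlaps with `φ` sum to `1` but are all below
`1 / d`. Orthogonal projectors with label `1` would contain orthogonal vectors whose overlaps with
`φ` both exceed `1 / 2`. -/
theorem isProjectorLabelling_inherited_overlapLabel [CompleteSpace H] {d r : ℕ}
    (hd : Module.finrank ℂ H = d) (hd2 : 2 ≤ d) {φ : H} (hφ : ‖φ‖ = 1)
    (S : Finset (H →L[ℂ] H)) (hS : ∀ P ∈ S, IsRankProjector r P) :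
    IsProjectorLabelling S (inherited (overlapLabel d φ)) where
  exists_ne_zero K _ hsum := by
    have : FiniteDimensional ℂ H := .of_finrank_pos (by omega)
    by_contra! h
    have h' (P : K) := exists_isDecomposition_of_inherited_eq_zero (h P P.2)
    choose n ψ hdec hzero using h'
    have hone : ∑ P : K, ∑ i, InnerProductSpace.rankOne ℂ (ψ P i) (ψ P i) = 1 := by
      rw [← hsum, ← Finset.sum_coe_sort K]
      exact Finset.sum_congr rfl fun P _ ↦ (hdec P).2.symm
    have hcard : ∑ P : K, n P = d := by
      have h1 := congrArg (fun T : H →L[ℂ] H ↦ LinearMap.trace ℂ H T) hone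
      simp only [ContinuousLinearMap.toLinearMap_sum, map_sum, InnerProductSpace.trace_rankOne,
        inner_self_eq_norm_sq_to_K, (hdec _).1.norm_eq_one] at h1
      rw [ContinuousLinearMap.toLinearMap_one, LinearMap.trace_one, hd] at h1
      simpa [← Nat.cast_sum] using h1
    have hnorm : ∑ P : K, ∑ i, ‖inner ℂ (ψ P i) φ‖ ^ 2 = 1 := by
      have h1 := congrArg (fun T : H →L[ℂ] H ↦ RCLike.re (inner ℂ φ (T φ))) hone
      simp only [sum_apply, InnerProductSpace.rankOne_apply, inner_sum,
        inner_smul_right, inner_mul_symm_re_eq_norm, map_sum, one_apply_eq_self,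
        inner_self_eq_norm_sq, hφ] at h1
      simpa [norm_mul, norm_inner_symm φ, ← sq] using h1
    have hlt : ∑ x : (Σ P : K, Fin (n P)), ‖inner ℂ (ψ x.1 x.2) φ‖ ^ 2 <
        ∑ _x : (Σ P : K, Fin (n P)), 1 / (d : ℝ) := by
      refine Finset.sum_lt_sum_of_nonempty ?_ fun x _ ↦
        (overlapLabel_eq_zero_iff hd2).1 (hzero x.1 x.2)
      rw [← Finset.card_pos, Finset.card_univ, Fintype.card_sigma]
      simp only [Fintype.card_fin, hcard]
      omega
    have h3 : (d : ℝ) ≠ 0 := by positivity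
    rw [Fintype.sum_sigma, hnorm, Finset.sum_const, Finset.card_univ, Fintype.card_sigma,
      Finset.sum_congr rfl fun P _ ↦ Fintype.card_fin (n P), hcard, nsmul_eq_mul,
      mul_one_div_cancel h3] at hlt
    exact hlt.false
  not_both_one P hPS Q hQS hPQ := by
    rintro ⟨h1, h2⟩
    obtain ⟨n, ψ, i, hψ, hi⟩ := exists_isDecomposition_of_inherited_eq_one h1
    obtain ⟨m, χ, j, hχ, hj⟩ := exists_isDecomposition_of_inherited_eq_one h2
    have horth : inner ℂ (ψ i) (χ j) = 0 := by
      have h3 := (hS P hPS).1.isSelfAdjoint.isSymmetric (ψ i) (χ j)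
      have h4 : P (Q (χ j)) = 0 := DFunLike.congr_fun hPQ (χ j)
      simp only [ContinuousLinearMap.coe_coe] at h3
      rw [← hψ.apply_self i, h3, ← hχ.apply_self j, h4, inner_zero_right]
    rw [overlapLabel_eq_one_iff] at hi hj
    linarith [norm_inner_sq_add_norm_inner_sq_le hφ (hψ.1.1 i) (hχ.1.1 j) horth]

end StateLabelling

end KSValuation

theorem mainTheorem3 {H : Type*} [NormedAddCommGroup H] [InnerProductSpace ℂ H] [CompleteSpace H]
    (d r : ℕ) (hd : Module.finrank ℂ H = d) (hr : 1 ≤ r) (hrd : 2 * r ≤ d)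
    (S : Finset (H →L[ℂ] H)) (hS : ∀ P ∈ S, KSValuation.IsRankProjector r P) :
    ∃ f : H → KSValuation.Label,
      KSValuation.IsStateLabelling f ∧
      KSValuation.IsProjectorLabelling S (KSValuation.inherited f) ∧
      ({P : H →L[ℂ] H | P ∈ S ∧
          KSValuation.inherited f P = KSValuation.Label.contextual}.ncard : ℝ) ≤
        (KSValuation.regIncBeta (1 / 2) r ((d : ℝ) - r)
          - KSValuation.regIncBeta ((r : ℝ) / d) r ((d : ℝ) - r)) * (S.card : ℝ) := by
  obtain ⟨s, rfl⟩ := Nat.exists_eq_add_of_le (show r ≤ d by omega)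
  have hs : 1 ≤ s := by omega
  have hcast : ((r + s : ℕ) : ℝ) - r = (s : ℝ) := by push_cast; ring
  have hle : (r : ℝ) / ((r + s : ℕ) : ℝ) ≤ 1 / 2 := by
    rw [div_le_div_iff₀ (by positivity) two_pos]
    exact_mod_cast (by omega : r * 2 ≤ 1 * (r + s))
  obtain ⟨φ, hφ, hcard⟩ := KSValuation.exists_ncard_sector_le hr hs hd S hS
    (a := (r : ℝ) / ((r + s : ℕ) : ℝ)) (b := 1 / 2) (by positivity) hle (by norm_num)
  refine ⟨KSValuation.overlapLabel (r + s) φ,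
    KSValuation.isStateLabelling_overlapLabel hd (by omega) hφ,
    KSValuation.isProjectorLabelling_inherited_overlapLabel hd (by omega) hφ S hS, ?_⟩
  rw [hcast]
  refine le_trans (Nat.cast_le.2 (Set.ncard_le_ncard ?_ ?_)) hcard
  · rintro P ⟨hPS, hP⟩
    refine ⟨hPS, ?_, ?_⟩
    · by_contra! h
      exact KSValuation.inherited_ne_contextual_of_lt (by omega) hr (hS P hPS) h hP
    · by_contra! h
      exact KSValuation.inherited_ne_contextual_of_gt (by omega) hr (hS P hPS) h hP
  · exact S.finite_toSet.subset fun P hP ↦ hP.1
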